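/- Let $E$ be a separable metrizable space with its Borel $\sigma$-algebra, let $K \ge 1$, and let $P_0, P_1, \dots, P_K$ be Markov transition kernels on $E$ with a common stationary probability measure $\pi$. Suppose that $P_0$ is uniquely ergodic, that is, $\pi$ is its only stationary probability measure. Let $P$ be a Markov transition kernel on $E^{K+1}$, whose points are written $z = (z_0, \dots, z_K)$, such that $P(\cdot \mid z)$ depends on $z$ only through $z_0$ and such that, for every $k = 0, \dots, K$ and every $z$, the $k$-th marginal of $P(\cdot \mid z)$ is $P_k(\cdot \mid z_0)$. Then: (a) For $\pi$-almost every starting value of the coordinate $z_0$, the averaged empirical measure of the coordinates $1, \dots, K$ converges weakly to $\pi$ almost surely. Precisely, there is a measurable set $G \subseteq E$ with $\pi(G) = 1$ such that for every Markov chain $(z^{(i)})_{i \ge 1}$ with transition kernel $P$ and $z_0^{(1)} \in G$ almost surely (the law of $z^{(1)}$ being otherwise arbitrary), almost surely $$\frac{1}{NK} \sum_{i=1}^N \sum_{k=1}^K \delta_{z_k^{(i)}} \xrightarrow{\ w\ } \pi \quad \text{as } N \to \infty .$$ (b) The kernel $P$ has exactly one stationary probability measure $\pi^*$. If $P_0$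 (with $\pi$) is geometrically ergodic, then so is $P$ (with $\pi^*$), and if $P_0$ is uniformly ergodic, then so is $P$. Here a kernel $Q$ with stationary probability measure $\mu$ is called geometrically ergodic if there are $\rho \in [0,1)$ and a function $M$ such that $\|Q^n(\cdot \mid x) - \mu\|_{\mathrm{tv}} \le M(x)\, \rho^n$ for all $n \ge 0$ and for $\mu$-almost every $x$; it is called uniformly ergodic if this holds for every $x$ with $M$ a constant. The statement on geometric ergodicity holds as well with "for every $x$" in place of "for $\mu$-almost every $x$" (in the hypothesis and in the conclusion). -/

import Mathlib

open MeasureTheory ProbabilityTheory Filter Topology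
open scoped NNReal

universe u w

/-- The total variation distance `sup_A |μ(A) - ν(A)|` over measurable sets `A`
(it is used for probability measures, where the supremum is at most one). -/
noncomputable def tvDist {α : Type*} [MeasurableSpace α] (μ ν : Measure α) : ℝ :=
  ⨆ A : {A : Set α // MeasurableSet A}, |μ.real A.1 - ν.real A.1|

/-- A transition kernel with exactly one stationary probability measure. -/
def UniquelyErgodic {α : Type*} [MeasurableSpace α] (P : Kernel α α) : Prop :=
  ∃! π : ProbabilityMeasure α, P.Invariant (π : Measure α)

/-- Geometric ergodicity of `P` with stationary probability measure `π`:
`‖P^n(x, ·) - π‖ ≤ M(x) ρ^n` for all `n`, with `ρ < 1` and `M` finite `π`-almost everywhere. -/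
def GeometricallyErgodic {α : Type*} [MeasurableSpace α] (P : Kernel α α)
    (π : ProbabilityMeasure α) : Prop :=
  P.Invariant (π : Measure α) ∧
    ∃ ρ : ℝ, 0 ≤ ρ ∧ ρ < 1 ∧ ∃ M : α → ℝ,
      ∀ᵐ x ∂(π : Measure α), ∀ n : ℕ, tvDist ((P ^ n) x) (π : Measure α) ≤ M x * ρ ^ n

/-- The variant of geometric ergodicity in which `M` is finite at every starting point. -/
def GeometricallyErgodicEverywhere {α : Type*} [MeasurableSpace α] (P : Kernel α α)
    (π : ProbabilityMeasure α) : Prop :=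
  P.Invariant (π : Measure α) ∧
    ∃ ρ : ℝ, 0 ≤ ρ ∧ ρ < 1 ∧ ∃ M : α → ℝ,
      ∀ x : α, ∀ n : ℕ, tvDist ((P ^ n) x) (π : Measure α) ≤ M x * ρ ^ n

/-- Uniform ergodicity of `P` with stationary probability measure `π`:
`‖P^n(x, ·) - π‖ ≤ M ρ^n` for all `n` and all `x`, with constants `ρ < 1` and `M`. -/
def UniformlyErgodic {α : Type*} [MeasurableSpace α] (P : Kernel α α)
    (π : ProbabilityMeasure α) : Prop :=
  P.Invariant (π : Measure α) ∧
    ∃ ρ : ℝ, 0 ≤ ρ ∧ ρ < 1 ∧ ∃ M : ℝ,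
      ∀ x : α, ∀ n : ℕ, tvDist ((P ^ n) x) (π : Measure α) ≤ M * ρ ^ n

/-- `Z 0, Z 1, …` is a time-homogeneous Markov chain with transition kernel `P`: the conditional
law of `Z (n + 1)` given the whole past `(Z 0, …, Z n)` is `P (Z n)`. The initial law is free. -/
structure IsMarkovChain {Ω α : Type*} [MeasurableSpace Ω] [MeasurableSpace α]
    (Z : ℕ → Ω → α) (P : Kernel α α) (μ : Measure Ω) : Prop where
  measurable : ∀ n, Measurable (Z n)
  transition : ∀ n, HasCondDistrib (Z (n + 1)) (fun ω (i : Finset.Iic n) => Z i ω)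
    (P.comap (fun h : Finset.Iic n → α => h ⟨n, Finset.mem_Iic.2 le_rfl⟩)
      (measurable_pi_apply _)) μ

/-- The averaged empirical measure `(N K)⁻¹ ∑_{i < N} ∑_{k = 1}^K δ_{z i k}` of the coordinates
`1, …, K` of the first `N` terms of a sequence in `E^{K+1}`. -/
noncomputable def empiricalMeasure {E : Type*} [MeasurableSpace E] {K : ℕ}
    (z : ℕ → Fin (K + 1) → E) (N : ℕ) : FiniteMeasure E :=
  ((N : ℝ≥0) * (K : ℝ≥0))⁻¹ •
    ∑ i ∈ Finset.range N, ∑ k : Fin K, (diracProba (z i k.succ)).toFiniteMeasure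

/-! The kernel `P` factors through the driving coordinate: `P z = Q (z 0)` for a Markov kernel `Q`
from `E` to `E^{K+1}`, and pushing `Q` forward to coordinate `0` gives `P₀`. Hence `μ ↦ μ.map e` and
`ν ↦ Q ∘ₘ ν` carry stationary measures of `P` and `P₀` to one another, so the only stationary
measure of `P` is `Q ∘ₘ π`. Moreover `P^(n+1) z = Q ∘ₘ P₀^n (z 0)`. Markov kernels do not increase
total variation, so rates for `P₀` pass to `P` with a delay of one step.

For (a), a law of large numbers is proved for the stationary chain of any uniquely ergodic kernel.
The probability of a shift-invariant event, as a function of the starting point, is harmonic, hence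
the density of a stationary measure; by unique ergodicity the event is independent of the initial
state. If `g` has negative mean, the maximal ergodic theorem on the event that its partial sums are
unbounded above then forces that event to be null. Applying this to `± g` minus constants gives
convergence of averages.

All marginals of `Q ∘ₘ π` equal `π`, so averaged coordinate frequencies converge to `π` on a
countable π-system of open sets, which is enough for weak convergence. From the second term on, the
law of the path depends on the initial law only through that of `z 0`; this gives the set `G`. -/

/-! ### Total variation distance and its contraction under Markov kernels -/

section tv

variable {α β : Type*} [MeasurableSpace α] [MeasurableSpace β]

lemma abs_measureReal_sub_le_one (μ ν : Measure α) [IsProbabilityMeasure μ]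
    [IsProbabilityMeasure ν] (A : Set α) : |μ.real A - ν.real A| ≤ 1 := by
  have h1 : μ.real A ≤ 1 := measureReal_le_one
  have h2 : ν.real A ≤ 1 := measureReal_le_one
  have h3 : 0 ≤ μ.real A := measureReal_nonneg
  have h4 : 0 ≤ ν.real A := measureReal_nonneg
  rw [abs_le]; constructor <;> linarith

lemma bddAbove_range_tvDist (μ ν : Measure α) [IsProbabilityMeasure μ] [IsProbabilityMeasure ν] :
    BddAbove (Set.range fun A : {A : Set α // MeasurableSet A} => |μ.real A.1 - ν.real A.1|) :=
  ⟨1, by rintro _ ⟨A, rfl⟩; exact abs_measureReal_sub_le_one μ ν A.1⟩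

lemma abs_measureReal_sub_le_tvDist (μ ν : Measure α) [IsProbabilityMeasure μ]
    [IsProbabilityMeasure ν] {A : Set α} (hA : MeasurableSet A) :
    |μ.real A - ν.real A| ≤ tvDist μ ν :=
  le_ciSup (bddAbove_range_tvDist μ ν) ⟨A, hA⟩

lemma tvDist_le {μ ν : Measure α} {c : ℝ}
    (h : ∀ A, MeasurableSet A → |μ.real A - ν.real A| ≤ c) : tvDist μ ν ≤ c :=
  haveI : Nonempty {A : Set α // MeasurableSet A} := ⟨⟨∅, MeasurableSet.empty⟩⟩
  ciSup_le fun A => h A.1 A.2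

lemma tvDist_le_one (μ ν : Measure α) [IsProbabilityMeasure μ] [IsProbabilityMeasure ν] :
    tvDist μ ν ≤ 1 :=
  tvDist_le fun A _ => abs_measureReal_sub_le_one μ ν A

lemma tvDist_nonneg (μ ν : Measure α) : 0 ≤ tvDist μ ν :=
  Real.iSup_nonneg fun _ => abs_nonneg _

/-- Layer cake representation for functions with values in `[0, 1]`. -/
lemma integral_eq_integral_Ioc_measureReal_lt (μ : Measure α) [IsProbabilityMeasure μ] {f : α → ℝ}
    (hf : Measurable f) (h0 : ∀ x, 0 ≤ f x) (h1 : ∀ x, f x ≤ 1) :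
    ∫ x, f x ∂μ = ∫ t in Set.Ioc (0 : ℝ) 1, μ.real {x | t < f x} := by
  have hint : Integrable f μ := Integrable.of_bound hf.aestronglyMeasurable 1
    (ae_of_all _ fun x => by rw [Real.norm_eq_abs, abs_of_nonneg (h0 x)]; exact h1 x)
  rw [hint.integral_eq_integral_meas_lt (ae_of_all _ h0)]
  apply setIntegral_eq_of_subset_of_forall_sdiff_eq_zero measurableSet_Ioi
  · exact Set.Ioc_subset_Ioi_self
  · rintro t ⟨ht, ht'⟩
    have : 1 < t := by
      by_contra hh
      exact ht' ⟨ht, not_lt.1 hh⟩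
    have : {x | t < f x} = ∅ := by
      ext x
      simp only [Set.mem_ofPred_eq, Set.mem_empty_iff_false, iff_false, not_lt]
      exact (h1 x).trans this.le
    rw [this]; simp

/-- By the layer cake formula the difference is an integral over levels `t ∈ (0, 1]`, an interval of
length one, of differences of measures of `{t < f}`. -/
lemma abs_integral_sub_le_tvDist (μ ν : Measure α) [IsProbabilityMeasure μ]
    [IsProbabilityMeasure ν] {f : α → ℝ}
    (hf : Measurable f) (h0 : ∀ x, 0 ≤ f x) (h1 : ∀ x, f x ≤ 1) :
    |∫ x, f x ∂μ - ∫ x, f x ∂ν| ≤ tvDist μ ν := by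
  have hi (ρ : Measure α) [IsProbabilityMeasure ρ] :
      IntegrableOn (fun t : ℝ => ρ.real {x | t < f x}) (Set.Ioc 0 1) := by
    have hm : Antitone fun t : ℝ => ρ.real {x | t < f x} := fun s t hst =>
      measureReal_mono fun x (hx : t < f x) => hst.trans_lt hx
    refine Integrable.of_bound hm.measurable.aestronglyMeasurable 1 (ae_of_all _ fun t => ?_)
    rw [Real.norm_eq_abs, abs_of_nonneg measureReal_nonneg]
    exact measureReal_le_one
  rw [integral_eq_integral_Ioc_measureReal_lt μ hf h0 h1,
    integral_eq_integral_Ioc_measureReal_lt ν hf h0 h1, ← integral_sub (hi μ) (hi ν)]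
  have := norm_setIntegral_le_of_norm_le_const (μ := volume) (s := Set.Ioc (0 : ℝ) 1)
    (f := fun t => μ.real {x | t < f x} - ν.real {x | t < f x}) (C := tvDist μ ν) (by simp)
    (fun t _ => abs_measureReal_sub_le_tvDist μ ν (measurableSet_lt measurable_const hf))
  simpa using this

lemma measureReal_comp (κ : Kernel α β) [IsMarkovKernel κ] (μ : Measure α) [IsProbabilityMeasure μ]
    {A : Set β} (hA : MeasurableSet A) : (κ ∘ₘ μ).real A = ∫ x, (κ x).real A ∂μ := by
  simp only [measureReal_def]
  rw [Measure.bind_apply hA κ.aemeasurable,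
    integral_toReal (κ.measurable_coe hA).aemeasurable (ae_of_all _ fun x => measure_lt_top _ _)]

lemma tvDist_comp_le (κ : Kernel α β) [IsMarkovKernel κ] (μ ν : Measure α)
    [IsProbabilityMeasure μ] [IsProbabilityMeasure ν] :
    tvDist (κ ∘ₘ μ) (κ ∘ₘ ν) ≤ tvDist μ ν := by
  refine tvDist_le fun A hA => ?_
  rw [measureReal_comp κ μ hA, measureReal_comp κ ν hA]
  exact abs_integral_sub_le_tvDist μ ν ((κ.measurable_coe hA).ennreal_toReal)
    (fun _ => measureReal_nonneg) (fun _ => measureReal_le_one)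

end tv

/-! ### Path laws of Markov chains -/

section chain

/-- The kernel sending `x` to the law of the path of the Markov chain with kernel `P`
started at `x`. -/
noncomputable def pathKernel {α : Type*} [MeasurableSpace α] (P : Kernel α α) [IsMarkovKernel P] :
    Kernel α (ℕ → α) :=
  (Kernel.traj (X := fun _ => α) (fun n => P.comap
    (fun h : Finset.Iic n → α => h ⟨n, Finset.mem_Iic.2 le_rfl⟩) (measurable_pi_apply _)) 0).comap
    (MeasurableEquiv.piUnique (fun _ : Finset.Iic 0 => α)).symm (MeasurableEquiv.measurable _)

variable {α : Type*} [MeasurableSpace α] (P : Kernel α α)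

instance [IsMarkovKernel P] : IsMarkovKernel (pathKernel P) := by
  unfold pathKernel; infer_instance

lemma pathKernel_comp [IsMarkovKernel P] (ν : Measure α) :
    pathKernel P ∘ₘ ν = Kernel.trajMeasure (X := fun _ => α) ν (fun n => P.comap
    (fun h : Finset.Iic n → α => h ⟨n, Finset.mem_Iic.2 le_rfl⟩) (measurable_pi_apply _)) := by
  rw [Kernel.trajMeasure, pathKernel]
  rw [← Measure.deterministic_comp_eq_map (MeasurableEquiv.measurable _), Measure.comp_assoc,
    Kernel.comp_deterministic_eq_comap]

lemma isMarkovChain_pathKernel [IsMarkovKernel P] (ν : Measure α) [IsProbabilityMeasure ν] :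
    IsMarkovChain (fun n (ω : ℕ → α) => ω n) P (pathKernel P ∘ₘ ν) where
  measurable n := measurable_pi_apply n
  transition n := by
    refine ⟨by fun_prop, ?_⟩
    rw [pathKernel_comp]
    exact (Kernel.map_frestrictLe_trajMeasure_compProd_eq_map_trajMeasure (a := n)).symm

variable {P} {Ω Ω' : Type*} [MeasurableSpace Ω] [MeasurableSpace Ω'] {μ : Measure Ω}
  {μ' : Measure Ω'} {Z : ℕ → Ω → α} {Z' : ℕ → Ω' → α}

lemma IsMarkovChain.hasCondDistrib [IsMarkovKernel P] [IsProbabilityMeasure μ]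
    (h : IsMarkovChain Z P μ) (n : ℕ) : HasCondDistrib (Z (n + 1)) (Z n) P μ :=
  (h.transition n).comp_right (f := fun h : Finset.Iic n → α => h ⟨n, Finset.mem_Iic.2 le_rfl⟩)

lemma IsMarkovChain.map_succ [IsMarkovKernel P] [IsProbabilityMeasure μ]
    (h : IsMarkovChain Z P μ) (n : ℕ) :
    μ.map (Z (n + 1)) = P ∘ₘ μ.map (Z n) := by
  have := (h.hasCondDistrib n).map_eq
  rw [← Measure.snd_compProd, ← this, Measure.snd_map_prodMk (h.measurable _)]

lemma IsMarkovChain.shift [IsMarkovKernel P] [IsProbabilityMeasure μ] (h : IsMarkovChain Z P μ) :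
    IsMarkovChain (fun n => Z (n + 1)) P μ where
  measurable n := h.measurable _
  transition n := by
    have hf : Measurable fun (x : Finset.Iic (n + 1) → α) (i : Finset.Iic n) =>
        x ⟨i + 1, Finset.mem_Iic.2 (Nat.succ_le_succ (Finset.mem_Iic.1 i.2))⟩ := by fun_prop
    exact HasCondDistrib.comp_right (hf := hf) (κ := P.comap (fun x : Finset.Iic n → α =>
      x ⟨n, Finset.mem_Iic.2 le_rfl⟩) (measurable_pi_apply _)) (h.transition (n + 1))

/-- The law of the path of a Markov chain is determined by its kernel and the initial law. -/
lemma IsMarkovChain.map_path_eq [IsProbabilityMeasure μ] [IsProbabilityMeasure μ']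
    (h : IsMarkovChain Z P μ) (h' : IsMarkovChain Z' P μ') (h0 : μ.map (Z 0) = μ'.map (Z' 0)) :
    μ.map (fun ω n => Z n ω) = μ'.map (fun ω n => Z' n ω) := by
  have hm : Measurable fun ω n => Z n ω := measurable_pi_lambda _ h.measurable
  have hm' : Measurable fun ω n => Z' n ω := measurable_pi_lambda _ h'.measurable
  have key (n : ℕ) : μ.map (fun ω (i : Finset.Iic n) => Z i ω)
      = μ'.map (fun ω (i : Finset.Iic n) => Z' i ω) := by
    induction n with
    | zero =>
      have hc : Measurable fun (x : α) (_ : Finset.Iic 0) => x := by fun_prop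
      have e1 := congrArg (Measure.map (fun (x : α) (_ : Finset.Iic 0) => x)) h0
      rw [Measure.map_map hc (h.measurable 0), Measure.map_map hc (h'.measurable 0)] at e1
      convert e1 using 2 <;>
      · ext ω ⟨i, hi⟩
        obtain rfl : i = 0 := by simpa using hi
        rfl
    | succ n ih =>
      have e := (h.transition n).map_eq
      rw [ih, ← (h'.transition n).map_eq] at e
      -- `g` appends the next state to the history, turning the joint law of (past, next state) into
      -- the law of the longer history.
      let g : (Finset.Iic n → α) × α → (Finset.Iic (n + 1) → α) := fun p i =>
        if hi : (i : ℕ) ≤ n then p.1 ⟨i, Finset.mem_Iic.2 hi⟩ else p.2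
      have hg : Measurable g := by
        refine measurable_pi_lambda _ fun i => ?_
        by_cases hi : (i : ℕ) ≤ n
        · simp only [g, hi, dite_true]; fun_prop
        · simp only [g, hi, dite_false]; fun_prop
      have m1 := h.measurable
      have m2 := h'.measurable
      have e1 := congrArg (Measure.map g) e
      rw [Measure.map_map hg (by fun_prop), Measure.map_map hg (by fun_prop)] at e1
      have aux (f : ℕ → α) (i : Finset.Iic (n + 1)) :
          f i = if (i : ℕ) ≤ n then f i else f (n + 1) := by
        split_ifs with hi
        · rfl
        · have := Finset.mem_Iic.1 i.2
          congr 1; omega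
      convert e1 using 2
      · ext ω i; exact aux (fun n => Z n ω) i
      · ext ω i; exact aux (fun n => Z' n ω) i
  have : IsProbabilityMeasure (μ'.map (fun ω n => Z' n ω)) :=
    Measure.isProbabilityMeasure_map hm'.aemeasurable
  refine IsProjectiveLimit.unique
    (P := fun I : Finset ℕ => (μ'.map (fun ω n => Z' n ω)).map I.restrict) ?_ fun I => rfl
  refine (isProjectiveLimit_nat_iff (fun I J hJI => ?_) _).2 fun n => ?_
  · exact (Measure.map_map (Finset.measurable_restrict₂ hJI) (Finset.measurable_restrict I)).symm
  · rw [Measure.map_map (by fun_prop) hm, Measure.map_map (by fun_prop) hm']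
    exact key n

lemma map_zero_pathKernel [IsMarkovKernel P] (ν : Measure α) [IsProbabilityMeasure ν] :
    (pathKernel P ∘ₘ ν).map (fun ω => ω 0) = ν := by
  have hm : Measurable fun x : Finset.Iic 0 → α => x ⟨0, by simp⟩ := measurable_pi_apply _
  have h1 : (fun ω : ℕ → α => ω 0) = (fun x : Finset.Iic 0 → α => x ⟨0, by simp⟩) ∘
    Preorder.frestrictLe (π := fun _ => α) 0 := rfl
  rw [h1, ← Measure.map_map hm (by fun_prop), pathKernel_comp, Kernel.trajMeasure,
    Measure.map_comp _ _ (by fun_prop), Kernel.traj_map_frestrictLe, Kernel.partialTraj_self,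
    Measure.id_comp, Measure.map_map hm (MeasurableEquiv.measurable _)]
  convert Measure.map_id
  rfl

lemma IsMarkovChain.map_path [IsMarkovKernel P] [IsProbabilityMeasure μ] (h : IsMarkovChain Z P μ) :
    μ.map (fun ω n => Z n ω) = pathKernel P ∘ₘ μ.map (Z 0) := by
  have : IsProbabilityMeasure (μ.map (Z 0)) :=
    Measure.isProbabilityMeasure_map (h.measurable 0).aemeasurable
  rw [h.map_path_eq (isMarkovChain_pathKernel P (μ.map (Z 0))) (map_zero_pathKernel _).symm]
  exact Measure.map_id

lemma map_shift_pathKernel [IsMarkovKernel P] (ν : Measure α) [IsProbabilityMeasure ν] :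
    (pathKernel P ∘ₘ ν).map (fun ω n => ω (n + 1)) = pathKernel P ∘ₘ (P ∘ₘ ν) := by
  have h := isMarkovChain_pathKernel P ν
  rw [h.shift.map_path, zero_add, h.map_succ 0, map_zero_pathKernel]

end chain

/-! ### Maximal ergodic theorem -/

section maximal

variable {X : Type*} {T : X → X} {f : X → ℝ}

/-- The maximum of `0` and the first `n` Birkhoff sums. -/
noncomputable def birkhoffMaximum (T : X → X) (f : X → ℝ) : ℕ → X → ℝ
  | 0, _ => 0
  | n + 1, x => max 0 (f x + birkhoffMaximum T f n (T x))

lemma birkhoffMaximum_nonneg (n : ℕ) (x : X) : 0 ≤ birkhoffMaximum T f n x := by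
  cases n with
  | zero => exact le_rfl
  | succ n => exact le_max_left _ _

lemma birkhoffMaximum_le_succ (n : ℕ) (x : X) :
    birkhoffMaximum T f n x ≤ birkhoffMaximum T f (n + 1) x := by
  induction n generalizing x with
  | zero => exact birkhoffMaximum_nonneg _ _
  | succ n ih => exact max_le_max le_rfl (by gcongr; exact ih _)

lemma monotone_birkhoffMaximum (x : X) : Monotone fun n => birkhoffMaximum T f n x :=
  monotone_nat_of_le_succ fun n => birkhoffMaximum_le_succ n x

lemma birkhoffSum_le_birkhoffMaximum (n : ℕ) (x : X) :
    birkhoffSum T f n x ≤ birkhoffMaximum T f n x := by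
  induction n generalizing x with
  | zero => simp [birkhoffMaximum]
  | succ n ih =>
    rw [birkhoffSum_succ']
    exact le_max_of_le_right (by gcongr; exact ih _)

/-- Where the maximum is positive, the term `0` does not attain it. This bounds `f` below by `M - M
∘ T`, the heart of Garsia's argument. -/
lemma birkhoffMaximum_le_of_pos (n : ℕ) (x : X) (h : 0 < birkhoffMaximum T f n x) :
    birkhoffMaximum T f n x ≤ f x + birkhoffMaximum T f n (T x) := by
  cases n with
  | zero => exact absurd h (lt_irrefl _)
  | succ n =>
    have h' : 0 < f x + birkhoffMaximum T f n (T x) := by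
      by_contra hh
      exact absurd h (by simp [birkhoffMaximum, not_lt.1 hh])
    calc birkhoffMaximum T f (n + 1) x = f x + birkhoffMaximum T f n (T x) := max_eq_right h'.le
      _ ≤ _ := by gcongr; exact birkhoffMaximum_le_succ _ _

variable [MeasurableSpace X] {m : Measure X}

lemma measurable_birkhoffMaximum (hT : Measurable T) (hf : Measurable f) (n : ℕ) :
    Measurable (birkhoffMaximum T f n) := by
  induction n with
  | zero => exact measurable_const
  | succ n ih => exact measurable_const.max (hf.add (ih.comp hT))

lemma integrable_birkhoffMaximum (hT : MeasurePreserving T m m)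
    (hfi : Integrable f m) (n : ℕ) : Integrable (birkhoffMaximum T f n) m := by
  induction n with
  | zero => exact integrable_zero _ _ _
  | succ n ih =>
    exact (integrable_zero _ _ _).sup (hfi.add (hT.integrable_comp_of_integrable ih))

/-- The maximal ergodic theorem on an invariant set. -/
lemma setIntegral_nonneg_of_forall_exists_birkhoffSum_pos (hT : MeasurePreserving T m m)
    (hf : Measurable f) (hfi : Integrable f m) {I : Set X} (hI : MeasurableSet I)
    (hTI : T ⁻¹' I = I) (hpos : ∀ x ∈ I, ∃ n, 0 < birkhoffSum T f n x) :
    0 ≤ ∫ x in I, f x ∂m := by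
  let A (n : ℕ) : Set X := I ∩ {x | 0 < birkhoffMaximum T f n x}
  have hA (n : ℕ) : MeasurableSet (A n) :=
    hI.inter (measurableSet_lt measurable_const (measurable_birkhoffMaximum hT.measurable hf n))
  have hAmono : Monotone A := fun a b hab x hx =>
    ⟨hx.1, lt_of_lt_of_le hx.2 (monotone_birkhoffMaximum x hab)⟩
  have hAU : ⋃ n, A n = I := by
    refine Set.Subset.antisymm (Set.iUnion_subset fun n => Set.inter_subset_left) fun x hx => ?_
    obtain ⟨n, hn⟩ := hpos x hx
    exact Set.mem_iUnion.2 ⟨n, hx, hn.trans_le (birkhoffSum_le_birkhoffMaximum n x)⟩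
  have hlim : Tendsto (fun n => ∫ x in A n, f x ∂m) atTop (𝓝 (∫ x in I, f x ∂m)) := by
    rw [← hAU]
    exact tendsto_setIntegral_of_monotone hA hAmono hfi.integrableOn
  refine ge_of_tendsto' hlim fun n => ?_
  have hM := integrable_birkhoffMaximum hT hfi n
  have hMT : Integrable (fun x => birkhoffMaximum T f n (T x)) m :=
    hT.integrable_comp_of_integrable hM
  have hle : ∫ x in A n, (birkhoffMaximum T f n x - birkhoffMaximum T f n (T x)) ∂m
      ≤ ∫ x in A n, f x ∂m :=
    setIntegral_mono_on (hM.sub hMT).integrableOn hfi.integrableOn (hA n) fun x hx => by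
      have := birkhoffMaximum_le_of_pos n x hx.2
      linarith
  refine le_trans ?_ hle
  rw [integral_sub hM.integrableOn hMT.integrableOn]
  -- The maximum vanishes on `I \ A n`, so enlarging the domain to `I` is free here, while for `M ∘
  -- T ≥ 0` it only increases the integral.
  have h1 : ∫ x in A n, birkhoffMaximum T f n x ∂m = ∫ x in I, birkhoffMaximum T f n x ∂m := by
    refine (setIntegral_eq_of_subset_of_forall_sdiff_eq_zero hI Set.inter_subset_left ?_).symm
    rintro x ⟨hx, hx'⟩
    exact le_antisymm (not_lt.1 fun h => hx' ⟨hx, h⟩) (birkhoffMaximum_nonneg _ _)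
  have h2 : ∫ x in A n, birkhoffMaximum T f n (T x) ∂m
      ≤ ∫ x in I, birkhoffMaximum T f n (T x) ∂m :=
    setIntegral_mono_set hMT.integrableOn (ae_of_all _ fun x => birkhoffMaximum_nonneg _ _)
      (Set.inter_subset_left.eventuallyLE)
  have h3 : ∫ x in I, birkhoffMaximum T f n (T x) ∂m = ∫ x in I, birkhoffMaximum T f n x ∂m := by
    have hR := hT.restrict_preimage hI
    rw [hTI] at hR
    rw [← integral_map (f := birkhoffMaximum T f n) hT.measurable.aemeasurable, hR.map_eq]
    rw [hR.map_eq]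
    exact (measurable_birkhoffMaximum hT.measurable hf n).aestronglyMeasurable
  linarith

end maximal

/-! ### Harmonic functions and stationary measures -/

section harmonic

variable {α : Type*} [MeasurableSpace α] {P : Kernel α α} {π : Measure α}
  [IsProbabilityMeasure π]

lemma snd_compProd_of_invariant [IsMarkovKernel P] (hπ : P.Invariant π) : (π ⊗ₘ P).snd = π := by
  rw [Measure.snd_compProd]; exact hπ

/-- A bounded harmonic function of a stationary Markov chain does not change along the chain. -/
lemma ae_eq_of_harmonic [IsMarkovKernel P] (hπ : P.Invariant π) {h : α → ℝ} (hm : Measurable h)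
    (h0 : ∀ x, 0 ≤ h x) (h1 : ∀ x, h x ≤ 1) (hh : ∀ x, ∫ y, h y ∂(P x) = h x) :
    ∀ᵐ p ∂(π ⊗ₘ P), h p.1 = h p.2 := by
  have hb {β : Type _} [MeasurableSpace β] (ρ : Measure β) [IsProbabilityMeasure ρ] {u v : β → α}
      (hu : Measurable u) (hv : Measurable v) : Integrable (fun b => h (u b) * h (v b)) ρ := by
    refine Integrable.of_bound (by fun_prop) 1 (ae_of_all _ fun b => ?_)
    rw [Real.norm_eq_abs, abs_of_nonneg (mul_nonneg (h0 _) (h0 _))]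
    exact mul_le_one₀ (h1 _) (h0 _) (h1 _)
  have e11 : ∫ p, h p.1 * h p.1 ∂(π ⊗ₘ P) = ∫ x, h x * h x ∂π := by
    rw [Measure.integral_compProd (hb _ measurable_fst measurable_fst)]
    simp
  have e12 : ∫ p, h p.1 * h p.2 ∂(π ⊗ₘ P) = ∫ x, h x * h x ∂π := by
    rw [Measure.integral_compProd (hb _ measurable_fst measurable_snd)]
    simp only [integral_const_mul, hh]
  have e22 : ∫ p, h p.2 * h p.2 ∂(π ⊗ₘ P) = ∫ x, h x * h x ∂π := by
    conv_rhs => rw [← snd_compProd_of_invariant hπ, Measure.snd]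
    rw [integral_map (by fun_prop) (by fun_prop)]
  have i11 := hb (π ⊗ₘ P) measurable_fst measurable_fst
  have i12 := hb (π ⊗ₘ P) measurable_fst measurable_snd
  have i22 := hb (π ⊗ₘ P) measurable_snd measurable_snd
  -- Stationarity evaluates `h p.2 ^ 2` and harmonicity the cross term; all three products have the
  -- same integral.
  have hz : ∫ p, (h p.1 - h p.2) ^ 2 ∂(π ⊗ₘ P) = 0 := by
    have : ∀ p : α × α, (h p.1 - h p.2) ^ 2
        = h p.1 * h p.1 - 2 * (h p.1 * h p.2) + h p.2 * h p.2 := fun p => by ring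
    simp only [this]
    have i1 : Integrable (fun p : α × α => h p.1 * h p.1 - 2 * (h p.1 * h p.2)) (π ⊗ₘ P) :=
      i11.sub (i12.const_mul 2)
    rw [integral_add i1 i22, integral_sub i11 (i12.const_mul 2),
      integral_const_mul, e11, e12, e22]
    ring
  have hi : Integrable (fun p : α × α => (h p.1 - h p.2) ^ 2) (π ⊗ₘ P) :=
    ((i11.sub (i12.const_mul 2)).add i22).congr (ae_of_all _ fun p => by simp; ring)
  filter_upwards [(integral_eq_zero_iff_of_nonneg (fun p => sq_nonneg _) hi).1 hz] with p hp
  exact sub_eq_zero.1 (pow_eq_zero_iff two_ne_zero |>.1 hp)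

/-- As `h` is almost surely unchanged by one step, the weight can be moved from the current state to
the next one, whose law is again `π`. -/
lemma invariant_withDensity_of_harmonic [IsMarkovKernel P] (hπ : P.Invariant π) {h : α → ℝ}
    (hm : Measurable h)
    (h0 : ∀ x, 0 ≤ h x) (h1 : ∀ x, h x ≤ 1) (hh : ∀ x, ∫ y, h y ∂(P x) = h x) :
    P.Invariant (π.withDensity fun x => ENNReal.ofReal (h x)) := by
  ext B hB
  have hB' : Measurable (B.indicator (1 : α → ENNReal)) := measurable_const.indicator hB
  have hm' : Measurable fun x => ENNReal.ofReal (h x) := hm.ennreal_ofReal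
  calc (P ∘ₘ π.withDensity fun x => ENNReal.ofReal (h x)) B
      = ∫⁻ x, ENNReal.ofReal (h x) * P x B ∂π := by
        rw [Measure.bind_apply hB P.aemeasurable,
          lintegral_withDensity_eq_lintegral_mul _ hm' (P.measurable_coe hB)]
        rfl
    _ = ∫⁻ p, ENNReal.ofReal (h p.1) * B.indicator 1 p.2 ∂(π ⊗ₘ P) := by
        rw [Measure.lintegral_compProd (by fun_prop)]
        refine lintegral_congr fun x => ?_
        dsimp only
        rw [lintegral_const_mul _ hB', lintegral_indicator_one hB]
    _ = ∫⁻ p, ENNReal.ofReal (h p.2) * B.indicator 1 p.2 ∂(π ⊗ₘ P) :=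
        lintegral_congr_ae ((ae_eq_of_harmonic hπ hm h0 h1 hh).mono fun p hp => by
          simp only [hp])
    _ = ∫⁻ y, ENNReal.ofReal (h y) * B.indicator 1 y ∂π := by
        conv_rhs => rw [← snd_compProd_of_invariant hπ, Measure.snd]
        rw [lintegral_map (by fun_prop) measurable_snd]
    _ = (π.withDensity fun x => ENNReal.ofReal (h x)) B := by
        rw [withDensity_apply _ hB, ← lintegral_indicator hB]
        refine lintegral_congr fun x => ?_
        by_cases hx : x ∈ B <;> simp [hx]

lemma UniquelyErgodic.eq_of_invariant (hP : UniquelyErgodic P) (hπ : P.Invariant π)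
    {ν : Measure α} [IsProbabilityMeasure ν] (hν : P.Invariant ν) : ν = π :=
  congrArg (fun ρ : ProbabilityMeasure α => (ρ : Measure α))
    (hP.unique (y₁ := ⟨ν, inferInstance⟩) (y₂ := ⟨π, inferInstance⟩) hν hπ)

/-- Every finite stationary measure of a uniquely ergodic kernel is a multiple of the stationary
probability measure. -/
lemma UniquelyErgodic.eq_smul_of_invariant (hP : UniquelyErgodic P) (hπ : P.Invariant π)
    {ν : Measure α} [IsFiniteMeasure ν] (hν : P.Invariant ν) : ν = ν Set.univ • π := by
  by_cases h : ν Set.univ = 0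
  · rw [h, zero_smul]; exact Measure.measure_univ_eq_zero.1 h
  have : NeZero ν := ⟨fun h' => h (by simp [h'])⟩
  have hinv : P.Invariant ((ν Set.univ)⁻¹ • ν) := by
    unfold Kernel.Invariant
    rw [Measure.comp_smul]
    exact congrArg _ hν
  rw [← hP.eq_of_invariant hπ hinv, smul_smul, ENNReal.mul_inv_cancel h (measure_ne_top _ _),
    one_smul]

end harmonic

/-! ### Law of large numbers under unique ergodicity -/

section lln

/-- The shift of paths. -/
def pathShift {α : Type*} (ω : ℕ → α) : ℕ → α := fun n => ω (n + 1)

lemma iterate_pathShift {α : Type*} (k : ℕ) (ω : ℕ → α) (n : ℕ) :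
    (pathShift^[k] ω) n = ω (n + k) := by
  induction k generalizing ω with
  | zero => rfl
  | succ k ih => rw [Function.iterate_succ_apply, ih]; simp only [pathShift]; congr 1

lemma birkhoffSum_pathShift {α : Type*} (g : α → ℝ) (n : ℕ) (ω : ℕ → α) :
    birkhoffSum pathShift (fun ω => g (ω 0)) n ω = ∑ i ∈ Finset.range n, g (ω i) := by
  simp only [birkhoffSum, iterate_pathShift, zero_add]

/-- The paths along which the partial sums of `g` are unbounded above. -/
def unboundedPaths {α : Type*} (g : α → ℝ) : Set (ℕ → α) :=
  {ω | ∀ k : ℕ, ∃ n, (k : ℝ) < ∑ i ∈ Finset.range n, g (ω i)}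

lemma preimage_pathShift_unboundedPaths {α : Type*} (g : α → ℝ) :
    pathShift ⁻¹' unboundedPaths g = unboundedPaths g := by
  have hs (n : ℕ) (ω : ℕ → α) : ∑ i ∈ Finset.range (n + 1), g (ω i)
      = ∑ i ∈ Finset.range n, g (pathShift ω i) + g (ω 0) := Finset.sum_range_succ' _ _
  ext ω
  constructor
  · intro h k
    obtain ⟨l, hl⟩ := exists_nat_ge (k - g (ω 0))
    obtain ⟨n, hn⟩ := h l
    exact ⟨n + 1, by rw [hs]; linarith⟩
  · intro h k
    obtain ⟨l, hl⟩ := exists_nat_ge (k + g (ω 0))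
    obtain ⟨n, hn⟩ := h l
    cases n with
    | zero =>
      simp only [Finset.range_zero, Finset.sum_empty] at hn
      exact absurd hn (not_lt.2 (Nat.cast_nonneg _))
    | succ n =>
      rw [hs] at hn
      exact ⟨n, by linarith⟩

lemma tendsto_const_mul_inv_natCast (k : ℝ) : Tendsto (fun n : ℕ => k * (n : ℝ)⁻¹) atTop (𝓝 0) := by
  simpa using (tendsto_inv_atTop_nhds_zero_nat (𝕜 := ℝ)).const_mul k

/-- The initial term is negligible after division by `n`. This matters because the law of the first
state is arbitrary. -/
lemma tendsto_average_of_pathShift {α : Type*} {g : α → ℝ} {ω : ℕ → α} {c : ℝ}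
    (h : Tendsto (fun n : ℕ => (∑ i ∈ Finset.range n, g (pathShift ω i)) * (n : ℝ)⁻¹)
      atTop (𝓝 c)) :
    Tendsto (fun n : ℕ => (∑ i ∈ Finset.range n, g (ω i)) * (n : ℝ)⁻¹) atTop (𝓝 c) := by
  rw [← tendsto_add_atTop_iff_nat 1]
  have hr : Tendsto (fun n : ℕ => (n : ℝ) * ((n + 1 : ℕ) : ℝ)⁻¹) atTop (𝓝 1) := by
    simpa [div_eq_mul_inv] using tendsto_natCast_div_add_atTop (1 : ℝ)
  have h0 := (tendsto_add_atTop_iff_nat 1).2 (tendsto_const_mul_inv_natCast (g (ω 0)))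
  have := (h.mul hr).add h0
  simp only [mul_one, add_zero] at this
  refine this.congr' ?_
  filter_upwards [eventually_gt_atTop 0] with n hn
  have hn' : (n : ℝ) ≠ 0 := by exact_mod_cast hn.ne'
  rw [Finset.sum_range_succ']
  simp only [pathShift]
  field_simp

variable {α : Type*} [MeasurableSpace α]

lemma measurable_pathShift : Measurable (pathShift (α := α)) := by
  unfold pathShift; fun_prop

lemma measurableSet_unboundedPaths {g : α → ℝ} (hg : Measurable g) :
    MeasurableSet (unboundedPaths g) := by
  have : unboundedPaths g
      = ⋂ k : ℕ, ⋃ n : ℕ, {ω | (k : ℝ) < ∑ i ∈ Finset.range n, g (ω i)} := by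
    ext ω; simp [unboundedPaths]
  rw [this]
  exact MeasurableSet.iInter fun k => MeasurableSet.iUnion fun n =>
    measurableSet_lt measurable_const (by fun_prop)

variable {P : Kernel α α} [IsMarkovKernel P] {π : Measure α} [IsProbabilityMeasure π]

lemma measurePreserving_pathShift (hπ : P.Invariant π) :
    MeasurePreserving pathShift (pathKernel P ∘ₘ π) (pathKernel P ∘ₘ π) where
  measurable := measurable_pathShift
  map_eq := (map_shift_pathKernel π).trans (congrArg (fun ν => pathKernel P ∘ₘ ν) hπ)

lemma pathKernel_map_pathShift (x : α) :
    (pathKernel P x).map pathShift = pathKernel P ∘ₘ P x := by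
  have h := map_shift_pathKernel (P := P) (Measure.dirac x)
  rw [Measure.dirac_bind (pathKernel P).measurable, Measure.dirac_bind P.measurable] at h
  exact h

lemma ae_pathKernel_zero (x : α) {B : Set α} (hB : MeasurableSet B) (hx : x ∈ B) :
    ∀ᵐ ω ∂(pathKernel P x), ω 0 ∈ B := by
  have h := map_zero_pathKernel (P := P) (Measure.dirac x)
  rw [Measure.dirac_bind (pathKernel P).measurable] at h
  have h2 : ∀ᵐ y ∂((pathKernel P x).map fun ω => ω 0), y ∈ B := by
    rw [h]
    exact (ae_dirac_iff hB).2 hx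
  exact ae_of_ae_map (measurable_pi_apply 0).aemeasurable h2

/-- The probability of a shift-invariant event, as a function of the starting point,
is harmonic. -/
lemma integral_pathKernel_of_invariant {I : Set (ℕ → α)} (hI : MeasurableSet I)
    (hTI : pathShift ⁻¹' I = I) (x : α) :
    ∫ y, (pathKernel P y).real I ∂(P x) = (pathKernel P x).real I := by
  rw [← measureReal_comp _ _ hI, ← pathKernel_map_pathShift, map_measureReal_apply
    measurable_pathShift hI, hTI]

/-- For a shift-invariant event, the initial point is independent of it if the kernel is uniquely
ergodic. -/
lemma map_zero_restrict_pathKernel (hP : UniquelyErgodic P) (hπ : P.Invariant π)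
    {I : Set (ℕ → α)} (hI : MeasurableSet I) (hTI : pathShift ⁻¹' I = I) :
    ((pathKernel P ∘ₘ π).restrict I).map (fun ω => ω 0) = (pathKernel P ∘ₘ π) I • π := by
  have hm0 : Measurable fun ω : ℕ → α => ω 0 := measurable_pi_apply 0
  -- A path started at `x` satisfies `ω 0 ∈ B` almost surely or almost never, according to whether
  -- `x ∈ B`.
  have hdens : ((pathKernel P ∘ₘ π).restrict I).map (fun ω => ω 0)
      = π.withDensity fun x => ENNReal.ofReal ((pathKernel P x).real I) := by
    ext B hB
    rw [Measure.map_apply hm0 hB, Measure.restrict_apply (hm0 hB),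
      Measure.bind_apply ((hm0 hB).inter hI) (pathKernel P).aemeasurable,
      withDensity_apply _ hB, ← lintegral_indicator hB]
    refine lintegral_congr fun x => ?_
    by_cases hx : x ∈ B
    · rw [Set.indicator_of_mem hx, ofReal_measureReal]
      refine measure_congr ?_
      filter_upwards [ae_pathKernel_zero (P := P) x hB hx] with ω hω
      exact propext ⟨fun h => h.2, fun h => ⟨hω, h⟩⟩
    · rw [Set.indicator_of_notMem hx]
      refine measure_mono_null (Set.inter_subset_left) ?_
      have := ae_pathKernel_zero (P := P) x hB.compl hx
      refine measure_mono_null (fun ω hω => ?_) (ae_iff.1 this)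
      exact not_not.2 hω
  have hinv : P.Invariant (((pathKernel P ∘ₘ π).restrict I).map (fun ω => ω 0)) := by
    rw [hdens]
    exact invariant_withDensity_of_harmonic hπ ((pathKernel P).measurable_coe hI).ennreal_toReal
      (fun _ => measureReal_nonneg) (fun _ => measureReal_le_one)
      (integral_pathKernel_of_invariant hI hTI)
  rw [hP.eq_smul_of_invariant hπ hinv]
  simp [Measure.map_apply hm0 MeasurableSet.univ]

/-- The partial sums of a function with negative mean are almost surely bounded above. -/
lemma ae_notMem_unboundedPaths (hP : UniquelyErgodic P) (hπ : P.Invariant π) {g : α → ℝ}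
    (hg : Measurable g) (hgi : Integrable g π) (hneg : ∫ x, g x ∂π < 0) :
    ∀ᵐ ω ∂(pathKernel P ∘ₘ π), ω ∉ unboundedPaths g := by
  set m := pathKernel P ∘ₘ π
  have hm0 : Measurable fun ω : ℕ → α => ω 0 := measurable_pi_apply 0
  have hI := measurableSet_unboundedPaths hg
  have hTI := preimage_pathShift_unboundedPaths g
  have hgi' : Integrable (fun ω : ℕ → α => g (ω 0)) m := by
    have : MeasurePreserving (fun ω : ℕ → α => ω 0) m π := ⟨hm0, map_zero_pathKernel π⟩
    exact this.integrable_comp_of_integrable hgi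
  have h1 : 0 ≤ ∫ ω in unboundedPaths g, g (ω 0) ∂m :=
    setIntegral_nonneg_of_forall_exists_birkhoffSum_pos (measurePreserving_pathShift hπ)
      (hg.comp hm0) hgi' hI hTI fun ω hω => by
        obtain ⟨n, hn⟩ := hω 0
        exact ⟨n, (by exact_mod_cast hn : (0 : ℝ) < _).trans_eq (birkhoffSum_pathShift g n ω).symm⟩
  -- Independence turns the integral into the probability of the event times the negative mean of
  -- `g`.
  rw [← integral_map (f := g) hm0.aemeasurable hg.aestronglyMeasurable,
    map_zero_restrict_pathKernel hP hπ hI hTI, integral_smul_measure, smul_eq_mul] at h1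
  have h2 : (m (unboundedPaths g)).toReal = 0 := by
    refine le_antisymm ?_ ENNReal.toReal_nonneg
    by_contra h
    exact absurd (mul_neg_of_pos_of_neg (not_le.1 h) hneg) (not_lt.2 h1)
  rw [ae_iff]
  simpa [ENNReal.toReal_eq_zero_iff, measure_ne_top] using h2

lemma ae_eventually_average_lt (hP : UniquelyErgodic P) (hπ : P.Invariant π) {g : α → ℝ}
    (hg : Measurable g) (hgi : Integrable g π) :
    ∀ᵐ ω ∂(pathKernel P ∘ₘ π), ∀ a > ∫ x, g x ∂π,
      ∀ᶠ n : ℕ in atTop, (∑ i ∈ Finset.range n, g (ω i)) * (n : ℝ)⁻¹ < a := by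
  have h (j : ℕ) : ∀ᵐ ω ∂(pathKernel P ∘ₘ π),
      ω ∉ unboundedPaths fun x => g x - (∫ x, g x ∂π + 1 / ((j : ℝ) + 1)) := by
    refine ae_notMem_unboundedPaths hP hπ (hg.sub_const _) (hgi.sub (integrable_const _)) ?_
    rw [integral_sub hgi (integrable_const _)]
    simp only [integral_const, probReal_univ, one_smul]
    have : 0 < 1 / ((j : ℝ) + 1) := by positivity
    linarith
  filter_upwards [ae_all_iff.2 h] with ω hω a ha
  obtain ⟨j, hj⟩ := exists_nat_one_div_lt (sub_pos.2 ha)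
  have hb := hω j
  simp only [unboundedPaths, Set.mem_ofPred_eq, not_forall, not_exists, not_lt] at hb
  obtain ⟨k, hk⟩ := hb
  have hlim := (tendsto_const_mul_inv_natCast (k : ℝ)).const_add (∫ x, g x ∂π + 1 / ((j : ℝ) + 1))
  filter_upwards [hlim.eventually_lt_const (u := a) (by linarith), eventually_gt_atTop 0]
    with n hn hn0
  have hn0' : (0 : ℝ) < n := by exact_mod_cast hn0
  refine lt_of_le_of_lt ?_ hn
  have := hk n
  rw [Finset.sum_sub_distrib, Finset.sum_const, Finset.card_range, nsmul_eq_mul] at this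
  rw [← div_eq_mul_inv, div_le_iff₀ hn0', add_mul, mul_assoc, inv_mul_cancel₀ hn0'.ne']
  linarith

/-- The law of large numbers for a stationary Markov chain with a uniquely ergodic kernel. -/
lemma ae_tendsto_average (hP : UniquelyErgodic P) (hπ : P.Invariant π) {g : α → ℝ}
    (hg : Measurable g) (hgi : Integrable g π) :
    ∀ᵐ ω ∂(pathKernel P ∘ₘ π), Tendsto
      (fun n : ℕ => (∑ i ∈ Finset.range n, g (ω i)) * (n : ℝ)⁻¹) atTop (𝓝 (∫ x, g x ∂π)) := by
  filter_upwards [ae_eventually_average_lt hP hπ hg hgi,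
    ae_eventually_average_lt hP hπ hg.neg hgi.neg] with ω h1 h2
  refine tendsto_order.2 ⟨fun a ha => ?_, h1⟩
  have := h2 (-a) (by simp only [Pi.neg_apply, integral_neg]; linarith)
  filter_upwards [this] with n hn
  simp only [Pi.neg_apply, Finset.sum_neg_distrib] at hn
  linarith

end lln

/-! ### Weak convergence of empirical measures -/

section weak

/-- Finite intersections from a countable basis. Countability lets the null sets of all test sets be
united. -/
lemma exists_countable_isPiSystem_nhds (E : Type*) [TopologicalSpace E]
    [SecondCountableTopology E] :
    ∃ S : Set (Set E), S.Countable ∧ IsPiSystem S ∧ (∀ s ∈ S, IsOpen s) ∧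
      ∀ u : Set E, IsOpen u → ∀ x ∈ u, ∃ s ∈ S, s ∈ 𝓝 x ∧ s ⊆ u := by
  let b := TopologicalSpace.countableBasis E
  have hb : TopologicalSpace.IsTopologicalBasis b := TopologicalSpace.isBasis_countableBasis E
  refine ⟨(fun f => ⋂₀ f) '' {f : Set (Set E) | f.Finite ∧ f ⊆ b}, ?_, ?_, ?_, ?_⟩
  · exact (Set.countable_ofPred_finite_subset (TopologicalSpace.countable_countableBasis E)).image _
  · rintro _ ⟨f, hf, rfl⟩ _ ⟨g, hg, rfl⟩ _
    exact ⟨f ∪ g, ⟨hf.1.union hg.1, Set.union_subset hf.2 hg.2⟩, Set.sInter_union f g⟩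
  · rintro _ ⟨f, hf, rfl⟩
    exact hf.1.isOpen_sInter fun s hs => hb.isOpen (hf.2 hs)
  · intro u hu x hx
    obtain ⟨s, hs, hxs, hsu⟩ := hb.exists_subset_of_mem_open hx hu
    exact ⟨s, ⟨{s}, ⟨Set.finite_singleton s, by simpa using hs⟩, by simp⟩,
      (hb.isOpen hs).mem_nhds hxs, hsu⟩

variable {E : Type*} [MeasurableSpace E] {K : ℕ}

/-- The proportion of the coordinates `1, …, K` of `z` that lie in `B`. -/
noncomputable def coordinateFrequency (B : Set E) (z : Fin (K + 1) → E) : ℝ :=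
  (K : ℝ)⁻¹ * ∑ k : Fin K, B.indicator 1 (z k.succ)

lemma measurable_coordinateFrequency {B : Set E} (hB : MeasurableSet B) :
    Measurable (coordinateFrequency (K := K) B) := by
  have : Measurable (B.indicator (1 : E → ℝ)) := measurable_const.indicator hB
  unfold coordinateFrequency
  fun_prop

lemma integrable_coordinateFrequency (m : Measure (Fin (K + 1) → E)) [IsProbabilityMeasure m]
    {B : Set E} (hB : MeasurableSet B) : Integrable (coordinateFrequency B) m := by
  have hk (k : Fin K) : Integrable (fun z => B.indicator (1 : E → ℝ) (z k.succ)) m :=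
    (integrable_const (1 : ℝ)).indicator (measurable_pi_apply k.succ hB)
  exact (integrable_finsetSum _ fun k _ => hk k).const_mul _

lemma integral_coordinateFrequency (hK : 1 ≤ K) {m : Measure (Fin (K + 1) → E)}
    [IsProbabilityMeasure m] {π : Measure E} (hm : ∀ k, m.map (fun z => z k) = π) {B : Set E}
    (hB : MeasurableSet B) : ∫ z, coordinateFrequency B z ∂m = π.real B := by
  have hK' : (K : ℝ) ≠ 0 := by positivity
  have hk (k : Fin K) : Integrable (fun z => B.indicator (1 : E → ℝ) (z k.succ)) m :=
    (integrable_const (1 : ℝ)).indicator (measurable_pi_apply k.succ hB)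
  have hint (k : Fin K) : ∫ z, B.indicator (1 : E → ℝ) (z k.succ) ∂m = π.real B := by
    have hBm : Measurable (B.indicator (1 : E → ℝ)) := measurable_const.indicator hB
    have hz : AEMeasurable (fun z : Fin (K + 1) → E => z k.succ) m :=
      (measurable_pi_apply k.succ).aemeasurable
    rw [← integral_map (f := B.indicator (1 : E → ℝ)) hz hBm.aestronglyMeasurable, hm,
      integral_indicator_one hB]
  unfold coordinateFrequency
  rw [integral_const_mul, integral_finsetSum _ fun k _ => hk k]
  simp only [hint, Finset.sum_const, Finset.card_univ, Fintype.card_fin, nsmul_eq_mul]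
  rw [inv_mul_cancel_left₀ hK']

lemma empiricalMeasure_real (z : ℕ → Fin (K + 1) → E) (N : ℕ) {B : Set E}
    (hB : MeasurableSet B) :
    (empiricalMeasure z N : Measure E).real B
      = (∑ i ∈ Finset.range N, coordinateFrequency B (z i)) * (N : ℝ)⁻¹ := by
  have h1 (x : E) : (((diracProba x).toFiniteMeasure : Measure E)).real B = B.indicator 1 x := by
    change (Measure.dirac x).real B = _
    rw [measureReal_def, Measure.dirac_apply' _ hB]
    by_cases hx : x ∈ B <;> simp [hx]
  rw [empiricalMeasure, FiniteMeasure.toMeasure_smul, measureReal_nnreal_smul_apply,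
    FiniteMeasure.toMeasure_sum, measureReal_def, Measure.finsetSum_apply,
    ENNReal.toReal_sum (fun _ _ => measure_ne_top _ _)]
  simp_rw [FiniteMeasure.toMeasure_sum, Measure.finsetSum_apply]
  simp_rw [ENNReal.toReal_sum (fun _ _ => measure_ne_top _ _), ← measureReal_def, h1,
    coordinateFrequency, ← Finset.mul_sum]
  push_cast
  rw [mul_inv]
  ring

lemma isProbabilityMeasure_empiricalMeasure (hK : 1 ≤ K) (z : ℕ → Fin (K + 1) → E) {N : ℕ}
    (hN : 1 ≤ N) : IsProbabilityMeasure (empiricalMeasure z N : Measure E) := by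
  have hK' : (K : ℝ) ≠ 0 := by positivity
  have hN' : (N : ℝ) ≠ 0 := by positivity
  have h := empiricalMeasure_real z N MeasurableSet.univ
  simp only [coordinateFrequency, Set.indicator_univ, Pi.one_apply, Finset.sum_const,
    Finset.card_univ, Fintype.card_fin, Finset.card_range, nsmul_eq_mul, mul_one,
    inv_mul_cancel₀ hK', mul_inv_cancel₀ hN'] at h
  exact ⟨by simpa [measureReal_def, ENNReal.toReal_eq_one_iff] using h⟩

lemma tendsto_empiricalMeasure [TopologicalSpace E] [SecondCountableTopology E]
    [OpensMeasurableSpace E] (hK : 1 ≤ K)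
    {S : Set (Set E)} (hS : IsPiSystem S) (hm : ∀ s ∈ S, MeasurableSet s)
    (hn : ∀ u : Set E, IsOpen u → ∀ x ∈ u, ∃ s ∈ S, s ∈ 𝓝 x ∧ s ⊆ u)
    (π : ProbabilityMeasure E) (z : ℕ → Fin (K + 1) → E)
    (h : ∀ s ∈ S, Tendsto (fun N : ℕ =>
      (∑ i ∈ Finset.range N, coordinateFrequency s (z i)) * (N : ℝ)⁻¹) atTop
      (𝓝 ((π : Measure E).real s))) :
    Tendsto (empiricalMeasure z) atTop (𝓝 π.toFiniteMeasure) := by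
  -- The index is shifted because the empirical measure of `N = 0` terms is zero, not a probability
  -- measure.
  let ν (N : ℕ) : ProbabilityMeasure E :=
    ⟨empiricalMeasure z (N + 1), isProbabilityMeasure_empiricalMeasure hK z (by omega)⟩
  rw [← tendsto_add_atTop_iff_nat 1]
  refine (ProbabilityMeasure.tendsto_nhds_iff_toFiniteMeasure_tendsto_nhds _ (μs := ν)).1 ?_
  refine hS.tendsto_probabilityMeasure_of_tendsto_of_mem hm hn fun s hs => ?_
  have := (tendsto_add_atTop_iff_nat 1).2 (h s hs)
  rw [← NNReal.tendsto_coe]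
  refine this.congr fun N => ?_
  exact (empiricalMeasure_real z (N + 1) (hm s hs)).symm

end weak

/-! ### Chains driven by a factor -/

section factor

variable {α β : Type*} [MeasurableSpace α] [MeasurableSpace β] {Q : Kernel α β} {e : β → α}

lemma comap_comp_measure (he : Measurable e) (μ : Measure β) :
    Q.comap e he ∘ₘ μ = Q ∘ₘ μ.map e := by
  rw [← Kernel.comp_deterministic_eq_comap, ← Measure.comp_assoc,
    Measure.deterministic_comp_eq_map]

lemma map_comp_measure (he : Measurable e) (μ : Measure α) :
    (Q ∘ₘ μ).map e = Q.map e ∘ₘ μ := Measure.map_comp _ _ he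

/-- Alternating `e` and `Q` can be regrouped: `n` steps of the driving chain, then one application
of `Q`. -/
lemma comap_pow_succ_apply (he : Measurable e) (n : ℕ) (z : β) :
    (Q.comap e he ^ (n + 1)) z = Q ∘ₘ ((Q.map e) ^ n) (e z) := by
  have h : Q.comap e he ^ (n + 1) = (Q ∘ₖ ((Q.map e) ^ n)).comap e he := by
    induction n with
    | zero =>
      have : (Q.map e) ^ 0 = Kernel.id := pow_zero _
      rw [this, Kernel.comp_id, zero_add, pow_one]
    | succ n ih =>
      have h1 : Q.comap e he ^ (n + 1 + 1) = (Q.comap e he ^ (n + 1)) ∘ₖ Q.comap e he :=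
        pow_succ _ _
      have h2 : (Q.map e) ^ (n + 1) = ((Q.map e) ^ n) ∘ₖ Q.map e := pow_succ _ _
      rw [h1, ih, h2, ← Kernel.comp_deterministic_eq_comap, ← Kernel.comp_deterministic_eq_comap,
        ← Kernel.comp_deterministic_eq_comap, ← Kernel.deterministic_comp_eq_map he]
      simp only [Kernel.comp_assoc]
  rw [h, Kernel.comap_apply, Kernel.comp_apply]

lemma invariant_comap (he : Measurable e) {π : Measure α} (hπ : (Q.map e).Invariant π) :
    (Q.comap e he).Invariant (Q ∘ₘ π) := by
  unfold Kernel.Invariant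
  rw [comap_comp_measure, map_comp_measure he]
  exact congrArg (fun ν => Q ∘ₘ ν) hπ

lemma invariant_map (he : Measurable e) {μ : Measure β} (hμ : (Q.comap e he).Invariant μ) :
    (Q.map e).Invariant (μ.map e) := by
  unfold Kernel.Invariant
  rw [← map_comp_measure he, ← comap_comp_measure he]
  exact congrArg (fun ν => ν.map e) hμ

variable [IsMarkovKernel Q]

/-- A stationary `μ` equals `Q ∘ₘ μ.map e`, and `μ.map e` is stationary for the driving chain, hence
`π`. -/
lemma uniquelyErgodic_comap (he : Measurable e) {π : Measure α} [IsProbabilityMeasure π]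
    (hπ : (Q.map e).Invariant π) (hQ : UniquelyErgodic (Q.map e)) :
    UniquelyErgodic (Q.comap e he) := by
  refine ⟨⟨Q ∘ₘ π, inferInstance⟩, invariant_comap he hπ, fun μ hμ => Subtype.ext ?_⟩
  have : IsProbabilityMeasure ((μ : Measure β).map e) :=
    Measure.isProbabilityMeasure_map he.aemeasurable
  have h := hQ.eq_of_invariant hπ (invariant_map he hμ)
  change (μ : Measure β) = Q ∘ₘ π
  rw [← h, ← comap_comp_measure he]
  exact hμ.symm

instance isMarkovKernel_pow (P : Kernel α α) [IsMarkovKernel P] (n : ℕ) :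
    IsMarkovKernel (P ^ n) := by
  induction n with
  | zero => exact inferInstanceAs (IsMarkovKernel Kernel.id)
  | succ n ih =>
    rw [show P ^ (n + 1) = (P ^ n) ∘ₖ P from pow_succ _ _]
    infer_instance

/-- A geometric rate of convergence of a chain carries over to a chain that it drives, with a
positive rate `r` in place of `ρ`. -/
lemma tvDist_comap_pow_le (he : Measurable e) {π : Measure α} [IsProbabilityMeasure π] {ρ r M : ℝ}
    (hρ : 0 ≤ ρ) (hρr : ρ ≤ r) (hr : 0 < r) {z : β}
    (h : ∀ n : ℕ, tvDist (((Q.map e) ^ n) (e z)) π ≤ M * ρ ^ n) (n : ℕ) :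
    tvDist ((Q.comap e he ^ n) z) (Q ∘ₘ π) ≤ max 1 (M / r) * r ^ n := by
  have : IsMarkovKernel (Q.map e) := Kernel.IsMarkovKernel.map Q he
  cases n with
  | zero =>
    -- At time `0` the driving chain gives no information; the trivial bound `1` accounts for the
    -- `max`.
    have := isMarkovKernel_pow (Q.comap e he) 0
    rw [pow_zero r, mul_one]
    exact (tvDist_le_one _ _).trans (le_max_left _ _)
  | succ n =>
    have hM : 0 ≤ M := by simpa using (tvDist_nonneg _ _).trans (h 0)
    rw [comap_pow_succ_apply he]
    calc tvDist (Q ∘ₘ ((Q.map e) ^ n) (e z)) (Q ∘ₘ π) ≤ tvDist (((Q.map e) ^ n) (e z)) π :=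
          tvDist_comp_le _ _ _
      _ ≤ M * ρ ^ n := h n
      _ ≤ M * r ^ n := by gcongr
      _ = M / r * r ^ (n + 1) := by rw [pow_succ]; field_simp
      _ ≤ _ := by gcongr; exact le_max_right _ _

/-- The one-step delay costs a division by the rate, and `ρ` may be `0`. -/
lemma exists_pos_rate {ρ : ℝ} (h0 : 0 ≤ ρ) (h1 : ρ < 1) : ∃ r : ℝ, 0 < r ∧ ρ ≤ r ∧ r < 1 :=
  ⟨(ρ + 1) / 2, by linarith, by linarith, by linarith⟩

lemma geometricallyErgodicEverywhere_comap (he : Measurable e) {π : ProbabilityMeasure α}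
    {πs : ProbabilityMeasure β} (hs : (πs : Measure β) = Q ∘ₘ (π : Measure α))
    (h : GeometricallyErgodicEverywhere (Q.map e) π) :
    GeometricallyErgodicEverywhere (Q.comap e he) πs := by
  obtain ⟨hπ, ρ, h0, h1, M, hM⟩ := h
  obtain ⟨r, hr0, hρr, hr1⟩ := exists_pos_rate h0 h1
  unfold GeometricallyErgodicEverywhere
  rw [hs]
  exact ⟨invariant_comap he hπ, r, hr0.le, hr1, fun z => max 1 (M (e z) / r), fun z n =>
    tvDist_comap_pow_le he h0 hρr hr0 (hM (e z)) n⟩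

lemma uniformlyErgodic_comap (he : Measurable e) {π : ProbabilityMeasure α}
    {πs : ProbabilityMeasure β} (hs : (πs : Measure β) = Q ∘ₘ (π : Measure α))
    (h : UniformlyErgodic (Q.map e) π) : UniformlyErgodic (Q.comap e he) πs := by
  obtain ⟨hπ, ρ, h0, h1, M, hM⟩ := h
  obtain ⟨r, hr0, hρr, hr1⟩ := exists_pos_rate h0 h1
  unfold UniformlyErgodic
  rw [hs]
  exact ⟨invariant_comap he hπ, r, hr0.le, hr1, max 1 (M / r), fun z n =>
    tvDist_comap_pow_le he h0 hρr hr0 (hM (e z)) n⟩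

lemma geometricallyErgodic_comap (he : Measurable e) {π : ProbabilityMeasure α}
    {πs : ProbabilityMeasure β} (hs : (πs : Measure β) = Q ∘ₘ (π : Measure α))
    (h : GeometricallyErgodic (Q.map e) π) : GeometricallyErgodic (Q.comap e he) πs := by
  obtain ⟨hπ, ρ, h0, h1, M, hM⟩ := h
  obtain ⟨r, hr0, hρr, hr1⟩ := exists_pos_rate h0 h1
  unfold GeometricallyErgodic
  rw [hs]
  -- The stationary measure projects to `π`, so a `π`-null set of driving values has a null
  -- preimage.
  have hmap : (Q ∘ₘ (π : Measure α)).map e = π := (map_comp_measure he _).trans hπ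
  rw [← hmap] at hM
  refine ⟨invariant_comap he hπ, r, hr0.le, hr1, fun z => max 1 (M (e z) / r), ?_⟩
  filter_upwards [ae_of_ae_map he.aemeasurable hM] with z hz n
  rw [hmap] at hz
  exact tvDist_comap_pow_le he h0 hρr hr0 hz n

/-- A property of the shifted path that holds almost surely for the stationary chain holds almost
surely for every chain that starts from almost every value of the driving coordinate. -/
lemma exists_measurableSet_forall_ae_shift (he : Measurable e) {π : Measure α}
    [IsProbabilityMeasure π] {A : Set (ℕ → β)} (hA : MeasurableSet A)
    (h : ∀ᵐ ω ∂(pathKernel (Q.comap e he) ∘ₘ (Q ∘ₘ π)), ω ∈ A) :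
    ∃ G : Set α, MeasurableSet G ∧ π Gᶜ = 0 ∧
      ∀ (Ω : Type w) [MeasurableSpace Ω] (μ : Measure Ω) [IsProbabilityMeasure μ]
        (Z : ℕ → Ω → β), IsMarkovChain Z (Q.comap e he) μ → (∀ᵐ ω ∂μ, e (Z 0 ω) ∈ G) →
        ∀ᵐ ω ∂μ, (fun n => Z (n + 1) ω) ∈ A := by
  rw [Measure.comp_assoc] at h
  set κ := pathKernel (Q.comap e he) ∘ₖ Q
  have hGm : MeasurableSet {x | κ x Aᶜ = 0} :=
    measurableSet_eq_fun (κ.measurable_coe hA.compl) measurable_const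
  refine ⟨{x | κ x Aᶜ = 0}, hGm, ?_, ?_⟩
  · exact Measure.ae_ae_of_ae_comp h
  · intro Ω _ μ _ Z hZ hG
    -- After one step the initial law enters only through its image under `e`.
    have hlaw : μ.map (fun ω n => Z (n + 1) ω) = κ ∘ₘ μ.map (fun ω => e (Z 0 ω)) := by
      rw [hZ.shift.map_path, zero_add, hZ.map_succ 0, comap_comp_measure he,
        Measure.map_map he (hZ.measurable 0), Measure.comp_assoc]
      rfl
    have hpath : ∀ᵐ y ∂(μ.map fun ω n => Z (n + 1) ω), y ∈ A := by
      rw [hlaw]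
      refine Measure.ae_comp_of_ae_ae hA ?_
      exact (ae_map_iff (he.comp (hZ.measurable 0)).aemeasurable hGm).2 hG
    exact ae_of_ae_map (measurable_pi_lambda _ fun n => hZ.measurable _).aemeasurable hpath

end factor

/-! ### The main theorem -/

theorem theorem3 {E : Type u} [TopologicalSpace E] [TopologicalSpace.MetrizableSpace E]
    [SecondCountableTopology E] [MeasurableSpace E] [BorelSpace E]
    (K : ℕ) (hK : 1 ≤ K)
    (Pk : Fin (K + 1) → Kernel E E) [∀ k, IsMarkovKernel (Pk k)]
    (π : ProbabilityMeasure E)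
    (hstat : ∀ k, (Pk k).Invariant (π : Measure E))
    (hP₀ : UniquelyErgodic (Pk 0))
    (P : Kernel (Fin (K + 1) → E) (Fin (K + 1) → E)) [IsMarkovKernel P]
    (hfirst : ∀ z z' : Fin (K + 1) → E, z 0 = z' 0 → P z = P z')
    (hmarg : ∀ (k : Fin (K + 1)) (z : Fin (K + 1) → E),
      (P z).map (fun z' => z' k) = Pk k (z 0)) :
    (∃ G : Set E, MeasurableSet G ∧ (π : Measure E) Gᶜ = 0 ∧
      ∀ (Ω : Type w) [MeasurableSpace Ω] (μ : Measure Ω) [IsProbabilityMeasure μ]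
        (Z : ℕ → Ω → Fin (K + 1) → E), IsMarkovChain Z P μ → (∀ᵐ ω ∂μ, Z 0 ω 0 ∈ G) →
        ∀ᵐ ω ∂μ, Tendsto (fun N => empiricalMeasure (fun i => Z i ω) N) atTop
          (𝓝 π.toFiniteMeasure)) ∧
    UniquelyErgodic P ∧
    ∃ πs : ProbabilityMeasure (Fin (K + 1) → E), P.Invariant (πs : Measure (Fin (K + 1) → E)) ∧
      (GeometricallyErgodic (Pk 0) π → GeometricallyErgodic P πs) ∧
      (GeometricallyErgodicEverywhere (Pk 0) π → GeometricallyErgodicEverywhere P πs) ∧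
      (UniformlyErgodic (Pk 0) π → UniformlyErgodic P πs) := by
  have hc : Measurable fun (x : E) (_ : Fin (K + 1)) => x := by fun_prop
  have he : Measurable fun z : Fin (K + 1) → E => z 0 := measurable_pi_apply 0
  -- Evaluating `P` at constant tuples gives a measurable choice of `Q`; `hfirst` makes the other
  -- coordinates irrelevant.
  obtain ⟨Q, hQ⟩ : ∃ Q, Q = P.comap (fun (x : E) (_ : Fin (K + 1)) => x) hc := ⟨_, rfl⟩
  have : IsMarkovKernel Q := by rw [hQ]; infer_instance
  obtain rfl : P = Q.comap (fun z => z 0) he := by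
    ext1 z
    rw [hQ, Kernel.comap_apply, Kernel.comap_apply]
    exact hfirst _ _ rfl
  have hQk (k : Fin (K + 1)) : Q.map (fun z => z k) = Pk k := by
    ext1 x
    rw [Kernel.map_apply _ (measurable_pi_apply k)]
    exact hmarg k fun _ => x
  have hQπ (k : Fin (K + 1)) : (Q ∘ₘ (π : Measure E)).map (fun z => z k) = π := by
    rw [map_comp_measure (measurable_pi_apply k), hQk]
    exact hstat k
  have hinv : (Q.map fun z => z 0).Invariant (π : Measure E) := by rw [hQk]; exact hstat 0
  have hPu : UniquelyErgodic (Q.comap (fun z => z 0) he) :=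
    uniquelyErgodic_comap he hinv (by rwa [hQk])
  refine ⟨?_, hPu, ⟨Q ∘ₘ (π : Measure E), inferInstance⟩, invariant_comap he hinv, ?_, ?_, ?_⟩
  · obtain ⟨S, hSc, hSpi, hSo, hSn⟩ := exists_countable_isPiSystem_nhds E
    have hSm : ∀ s ∈ S, MeasurableSet s := fun s hs => (hSo s hs).measurableSet
    let A : Set (ℕ → Fin (K + 1) → E) := {ω | ∀ s ∈ S, Tendsto (fun N : ℕ =>
      (∑ i ∈ Finset.range N, coordinateFrequency s (ω i)) * (N : ℝ)⁻¹) atTop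
      (𝓝 ((π : Measure E).real s))}
    have hA : MeasurableSet A := by
      have : A = ⋂ s ∈ S, {ω | Tendsto (fun N : ℕ =>
          (∑ i ∈ Finset.range N, coordinateFrequency s (ω i)) * (N : ℝ)⁻¹) atTop
          (𝓝 ((π : Measure E).real s))} := by
        ext ω; simp [A]
      rw [this]
      refine MeasurableSet.biInter hSc fun s hs => measurableSet_tendsto _ fun N => ?_
      have := measurable_coordinateFrequency (K := K) (hSm s hs)
      fun_prop
    have hAae : ∀ᵐ ω ∂(pathKernel (Q.comap (fun z => z 0) he) ∘ₘ (Q ∘ₘ (π : Measure E))),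
        ω ∈ A := by
      refine (ae_ball_iff hSc).2 fun s hs => ?_
      rw [← integral_coordinateFrequency hK hQπ (hSm s hs)]
      exact ae_tendsto_average hPu (invariant_comap he hinv)
        (measurable_coordinateFrequency (hSm s hs))
        (integrable_coordinateFrequency _ (hSm s hs))
    obtain ⟨G, hG, hG0, h⟩ := exists_measurableSet_forall_ae_shift.{w} he hA hAae
    refine ⟨G, hG, hG0, fun Ω _ μ _ Z hZ hZG => ?_⟩
    filter_upwards [h Ω μ Z hZ hZG] with ω hω
    exact tendsto_empiricalMeasure hK hSpi hSm hSn π (fun i => Z i ω) fun s hs =>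
      tendsto_average_of_pathShift (ω := fun i => Z i ω) (hω s hs)
  · exact fun h => geometricallyErgodic_comap he rfl (by rwa [hQk])
  · exact fun h => geometricallyErgodicEverywhere_comap he rfl (by rwa [hQk])
  · exact fun h => uniformlyErgodic_comap he rfl (by rwa [hQk])
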